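/- Let $n\ge 1$, and for an open set $S\subset\mathbb{R}^n$ write $|S|$ for its Lebesgue measure and $|\partial S|$ for the $(n-1)$-dimensional Hausdorff measure of its topological boundary. Let $\Omega\subset\mathbb{R}^n$ be open, with Cheeger constant $$h_\Omega=\inf\Big\{\frac{|\partial S|}{|S|} : S\subset\Omega \text{ open and nonempty},\ |S|<\infty\Big\}\in[0,\infty]$$ (the infimum of the empty set being $\infty$). Let $\mathcal S$ be a class of nonempty open subsets of $\Omega$ with Lipschitz boundary (i.e. near each of its boundary points, $S$ is the part of the space strictly above the graph of a Lipschitz function in a suitable orthonormal coordinate system; neither boundedness nor connectedness is required), such that $$h_\Omega=\inf\Big\{\frac{|\partial S|}{|S|} : S\in\mathcal S,\ |S|<\infty\Big\}.$$ Let $h\in\mathbb{R}$. Suppose that for each $S\in\mathcal S$ there is a vector field $V_S\in L^\infty(S,\mathbb{R}^n)$ of bounded variation (i.e. all distributional first derivatives of its components on $S$ are finite signed measures; in particular its distributional divergence $\operatorname{div}V_S$ is a finite signed measure on $S$) satisfying $$|V_S|\le 1\ \text{ almost everywhere on } S,\qquad \int_S \operatorname{div}V_S:=(\operatorname{div}V_S)(S)\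 \ge\ h\,|S|$$ (as an inequality in $[-\infty,\infty]$ with $0\cdot\infty=0$). Then $h_\Omega\ge h$. -/

import Mathlib

open MeasureTheory Set
open scoped ENNReal NNReal ContDiff

noncomputable section

namespace CheegerField

/-- `φ` is a smooth real function with compact support contained in `S`. -/
def IsTestFunction {n : ℕ} (S : Set (EuclideanSpace ℝ (Fin n)))
    (φ : EuclideanSpace ℝ (Fin n) → ℝ) : Prop :=
  ContDiff ℝ ∞ φ ∧ HasCompactSupport φ ∧ tsupport φ ⊆ S

/-- On the open set `S`, the distributional partial derivative `∂f/∂xⱼ` is the (finite) signed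
measure `μ`. Only the values of `μ` on subsets of `S` matter. -/
def HasPartialMeasure {n : ℕ} (S : Set (EuclideanSpace ℝ (Fin n)))
    (f : EuclideanSpace ℝ (Fin n) → ℝ) (j : Fin n)
    (μ : SignedMeasure (EuclideanSpace ℝ (Fin n))) : Prop :=
  ∀ φ : EuclideanSpace ℝ (Fin n) → ℝ, IsTestFunction S φ →
    ∫ x in S, f x * fderiv ℝ φ x (EuclideanSpace.single j 1) = -∫ᵛ x, φ x ∂<•μ

/-- On the open set `S`, the distributional divergence of `V` is the (finite) signed measure `μ`:
`∫_S V · ∇φ = -∫ φ dμ` for all test functions `φ`. The integral `∫_S div V` is then `μ S`. -/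
def HasDivMeasure {n : ℕ} (S : Set (EuclideanSpace ℝ (Fin n)))
    (V : EuclideanSpace ℝ (Fin n) → EuclideanSpace ℝ (Fin n))
    (μ : SignedMeasure (EuclideanSpace ℝ (Fin n))) : Prop :=
  ∀ φ : EuclideanSpace ℝ (Fin n) → ℝ, IsTestFunction S φ →
    ∫ x in S, fderiv ℝ φ x (V x) = -∫ᵛ x, φ x ∂<•μ

/-- The class of essentially bounded vector fields on `S` of bounded variation: all distributional
first derivatives `∂Vᵢ/∂xⱼ` on `S` are signed measures. -/
def MemXBV {n : ℕ} (S : Set (EuclideanSpace ℝ (Fin n)))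
    (V : EuclideanSpace ℝ (Fin n) → EuclideanSpace ℝ (Fin n)) : Prop :=
  MemLp V ⊤ (volume.restrict S) ∧
    ∀ i j : Fin n, ∃ μ : SignedMeasure (EuclideanSpace ℝ (Fin n)),
      HasPartialMeasure S (fun x => V x i) j μ

/-- `S` has Lipschitz boundary: near every boundary point, `S` is the set of points lying strictly
above the graph of a Lipschitz function over a hyperplane, the direction `e` (orthogonal to the
hyperplane) pointing upwards. -/
def HasLipschitzBoundary {n : ℕ} (S : Set (EuclideanSpace ℝ (Fin n))) : Prop :=
  ∀ x ∈ frontier S, ∃ e : EuclideanSpace ℝ (Fin n), ‖e‖ = 1 ∧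
    ∃ (K : ℝ≥0) (γ : (ℝ ∙ e)ᗮ → ℝ), LipschitzWith K γ ∧
      ∃ r : ℝ, 0 < r ∧ ∀ y ∈ Metric.ball x r,
        (y ∈ S ↔ γ ((ℝ ∙ e)ᗮ.orthogonalProjectionOnto y) < inner ℝ e y)

/-- The isoperimetric ratio `|∂S| / |S|`: `(n-1)`-dimensional Hausdorff measure (normalised to agree
with Lebesgue measure) of the topological boundary over Lebesgue measure of `S`. -/
def isoRatio {n : ℕ} (S : Set (EuclideanSpace ℝ (Fin n))) : ℝ≥0∞ :=
  Measure.euclideanHausdorffMeasure (n - 1) (frontier S) / volume S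

/-- The infimum of the isoperimetric ratios of the members of `𝒞` of finite volume, i.e. of those
for which the quotient makes sense; it is `∞` if there are none. -/
def infIsoRatio {n : ℕ} (𝒞 : Set (Set (EuclideanSpace ℝ (Fin n)))) : ℝ≥0∞ :=
  ⨅ S ∈ 𝒞, ⨅ _ : volume S < ⊤, isoRatio S

/-- The Cheeger constant of `Ω`: the infimum of `|∂S| / |S|` over nonempty open `S ⊆ Ω`. -/
def cheegerConstant {n : ℕ} (Ω : Set (EuclideanSpace ℝ (Fin n))) : ℝ≥0∞ :=
  infIsoRatio {S | IsOpen S ∧ S.Nonempty ∧ S ⊆ Ω}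

end CheegerField

end

/-!
Fix a member `S` of the class with finite volume and finite surface measure, a field `V` with
`‖V‖ ≤ 1` on `S`, and its divergence `μ`. The theorem reduces to `μ S ≤ H(∂S)`, where `H` is the
`(n - 1)`-dimensional Hausdorff measure (`divergence_le_perimeter`).

For a smooth compactly supported `ζ` let `T ζ = ∫_S ζ dμ + ∫_S V · ∇ζ` (`boundaryFlux`). It vanishes
if `ζ` is a test function in `S`, and `T ζ` tends to `μ S` along cutoff functions tending to `1`
whose gradients tend uniformly to `0`, because `S` has finite volume. So it is enough to prove
`T ζ ≤ ∫_{∂S} ζ dH` for `ζ ≥ 0`, and by a partition of unity this may be done for `ζ` supported in a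
Lipschitz chart.

In such a chart, `S` is pushed inwards along the direction of the graph and its indicator function
is mollified at a much smaller scale. The resulting functions `φ` vanish near `∂S` within the chart,
so that `ζ φ` is a test function in `S`, and they tend to `1` on `S`; hence `T ζ` is the limit of
`-∫_S ζ V · ∇φ`.
The gradient of `φ` is controlled, with the sharp constant `1`, by the mollified surface measure
(`fderiv_smoothedIndicator_le`), and Fubini's theorem gives `∫_{∂S} ζ dH` in the limit.

The gradient bound needs neither the area formula nor rectifiability. The difference of the
indicator functions of `S` and of its translate by a vector `v` lives on the set swept by `∂S` along
`v`. The volume of that set is at most `‖v‖ H(∂S)` (`volume_add_segment_le`): a thin layer of `∂S`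
orthogonal to `v` sweeps little more than a cylinder of height `‖v‖` over its orthogonal projection,
and orthogonal projections do not increase `H`.
-/

namespace CheegerField

open Filter Topology Pointwise

variable {n : ℕ}

/-! ### Volume swept by a set along a segment -/

theorem euclideanHausdorffMeasure_image_le {X Y : Type*} [EMetricSpace X] [MeasurableSpace X]
    [BorelSpace X] [EMetricSpace Y] [MeasurableSpace Y] [BorelSpace Y] {f : X → Y}
    (hf : LipschitzWith 1 f) (d : ℕ) (s : Set X) : μHE[d] (f '' s) ≤ μHE[d] s := by
  rw [Measure.euclideanHausdorffMeasure_def, Measure.euclideanHausdorffMeasure_def,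
    Measure.smul_apply, Measure.smul_apply]
  gcongr
  simpa using hf.hausdorffMeasure_image_le (d := (d : ℝ)) (by positivity) s

theorem inner_starProjection_span (ν x : EuclideanSpace ℝ (Fin n)) :
    inner ℝ ν ((ℝ ∙ ν).starProjection x) = inner ℝ ν x := by
  have h := (ℝ ∙ ν).sub_starProjection_mem_orthogonal x
  have h2 := Submodule.inner_right_of_mem_orthogonal (Submodule.mem_span_singleton_self ν) h
  rw [inner_sub_right] at h2
  linarith

theorem volume_inner_mem_Icc {ν : EuclideanSpace ℝ (Fin n)} (hν : ‖ν‖ = 1) (a b : ℝ) :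
    volume {k : (ℝ ∙ ν) | inner ℝ ν (k : EuclideanSpace ℝ (Fin n)) ∈ Icc a b}
      = ENNReal.ofReal (b - a) := by
  have h := (LinearIsometryEquiv.toSpanUnitSingleton (𝕜 := ℝ) ν hν).measurePreserving
  rw [← h.measure_preimage, ← Real.volume_Icc]
  · congr 1
    ext t
    simp [inner_smul_right, hν]
  · exact (measurableSet_Icc.preimage (by fun_prop)).nullMeasurableSet

theorem volume_cylinder {ν : EuclideanSpace ℝ (Fin n)} (hν : ‖ν‖ = 1) (B : Set (ℝ ∙ ν)ᗮ)
    (a b : ℝ) :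
    volume {x : EuclideanSpace ℝ (Fin n) |
      inner ℝ ν x ∈ Icc a b ∧ (ℝ ∙ ν)ᗮ.orthogonalProjectionOnto x ∈ B}
      = ENNReal.ofReal (b - a) * volume B := by
  have h := (ℝ ∙ ν).measurePreserving_measurableEquivProd (0 : EuclideanSpace ℝ (Fin n))
  rw [InnerProductSpace.euclideanHausdorffMeasure_eq_volume] at h
  rw [← volume_inner_mem_Icc hν, ← Measure.prod_prod, ← Measure.volume_eq_prod,
    ← h.measure_preimage_equiv]
  congr 1
  ext x
  simp [inner_starProjection_span]

/-- A set contained in a layer orthogonal to the unit vector `ν` sweeps, along `s • ν`, part of a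
cylinder over its orthogonal projection, of height `s` plus the thickness of the layer. -/
theorem volume_strip_add_segment_le (hn : 1 ≤ n) {ν : EuclideanSpace ℝ (Fin n)} (hν : ‖ν‖ = 1)
    {s a b : ℝ} (hs : 0 ≤ s) {A : Set (EuclideanSpace ℝ (Fin n))}
    (hA : ∀ x ∈ A, inner ℝ ν x ∈ Icc a b) :
    volume (A + segment ℝ 0 (s • ν)) ≤ ENNReal.ofReal (b - a + s) * μHE[n - 1] A := by
  have hν0 : ν ≠ 0 := by rintro rfl; simp at hν
  have hfin : Module.finrank ℝ (ℝ ∙ ν)ᗮ = n - 1 := by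
    have : Fact (Module.finrank ℝ (EuclideanSpace ℝ (Fin n)) = (n - 1) + 1) :=
      ⟨by simp; omega⟩
    exact Submodule.finrank_orthogonal_span_singleton hν0
  calc volume (A + segment ℝ 0 (s • ν))
      ≤ volume {x : EuclideanSpace ℝ (Fin n) | inner ℝ ν x ∈ Icc a (b + s) ∧
        (ℝ ∙ ν)ᗮ.orthogonalProjectionOnto x ∈ (ℝ ∙ ν)ᗮ.orthogonalProjectionOnto '' A} := by
        apply measure_mono
        rintro _ ⟨x, hx, y, hy, rfl⟩
        rw [segment_eq_image] at hy
        obtain ⟨θ, hθ, rfl⟩ := hy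
        have h1 := hA x hx
        simp only [smul_zero, zero_add, mem_ofPred_eq, inner_add_right, inner_smul_right,
          real_inner_self_eq_norm_sq, hν, map_add, map_smul]
        refine ⟨⟨by nlinarith [h1.1, hθ.1], by nlinarith [h1.2, hθ.2]⟩, x, hx, ?_⟩
        have : (ℝ ∙ ν)ᗮ.orthogonalProjectionOnto ν = 0 :=
          Submodule.orthogonalProjectionOnto_orthogonalComplement_singleton_eq_zero ν
        rw [this]; simp
    _ = ENNReal.ofReal (b - a + s) * volume ((ℝ ∙ ν)ᗮ.orthogonalProjectionOnto '' A) := by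
        rw [volume_cylinder hν]; congr 2; ring
    _ ≤ ENNReal.ofReal (b - a + s) * μHE[n - 1] A := by
        gcongr
        rw [← InnerProductSpace.euclideanHausdorffMeasure_eq_volume, hfin]
        exact euclideanHausdorffMeasure_image_le
          (Submodule.lipschitzWith_orthogonalProjectionOnto _) _ _

theorem volume_add_segment_le_add (hn : 1 ≤ n) {ν : EuclideanSpace ℝ (Fin n)} (hν : ‖ν‖ = 1)
    {s δ : ℝ} (hs : 0 ≤ s) (hδ : 0 < δ) {A : Set (EuclideanSpace ℝ (Fin n))}
    (hA : MeasurableSet A) :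
    volume (A + segment ℝ 0 (s • ν)) ≤ ENNReal.ofReal (δ + s) * μHE[n - 1] A := by
  set T : ℤ → Set (EuclideanSpace ℝ (Fin n)) :=
    fun j => A ∩ {x | ⌊inner ℝ ν x / δ⌋ = j} with hT
  have hmeas : ∀ j, MeasurableSet (T j) := fun j =>
    hA.inter (measurableSet_eq_fun (Int.measurable_floor.comp (by fun_prop)) measurable_const)
  have hdisj : Pairwise (Function.onFun Disjoint T) := by
    intro i j hij
    rw [Function.onFun, Set.disjoint_left]
    rintro x ⟨-, h1⟩ ⟨-, h2⟩
    exact hij (h1.symm.trans h2)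
  have hU : A = ⋃ j, T j := by
    ext x; simp [hT]
  calc volume (A + segment ℝ 0 (s • ν))
      = volume (⋃ j, (T j + segment ℝ 0 (s • ν))) := by rw [← iUnion_add, ← hU]
    _ ≤ ∑' j, volume (T j + segment ℝ 0 (s • ν)) := measure_iUnion_le _
    _ ≤ ∑' j, ENNReal.ofReal (δ + s) * μHE[n - 1] (T j) := by
        refine ENNReal.tsum_le_tsum fun j => ?_
        have := volume_strip_add_segment_le hn hν hs (A := T j) (a := j * δ) (b := (j + 1) * δ) ?_
        · convert this using 3; ring
        · rintro x ⟨-, hx⟩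
          have hx' : ⌊inner ℝ ν x / δ⌋ = j := hx
          rw [Int.floor_eq_iff, le_div_iff₀ hδ, div_lt_iff₀ hδ] at hx'
          exact ⟨hx'.1, hx'.2.le⟩
    _ = ENNReal.ofReal (δ + s) * μHE[n - 1] A := by
        rw [ENNReal.tsum_mul_left, ← measure_iUnion hdisj hmeas, ← hU]

/-- Sweeping a set `A` along a vector `v` covers a volume at most `‖v‖` times the
`(n - 1)`-dimensional measure of `A`. The set is cut into thin layers orthogonal to `v`, and the
projection along `v` does not increase Hausdorff measure. The case `v = 0` is excluded because of
the convention `0 * ∞ = 0`. -/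
theorem volume_add_segment_le (hn : 1 ≤ n) {v : EuclideanSpace ℝ (Fin n)} (hv : v ≠ 0)
    {A : Set (EuclideanSpace ℝ (Fin n))} (hA : MeasurableSet A) :
    volume (A + segment ℝ 0 v) ≤ ENNReal.ofReal ‖v‖ * μHE[n - 1] A := by
  by_cases htop : μHE[n - 1] A = ⊤
  · rw [htop, ENNReal.mul_top (by simpa using hv)]
    exact le_top
  have hν : ‖(‖v‖⁻¹ • v)‖ = 1 := by
    rw [norm_smul, norm_inv, norm_norm, inv_mul_cancel₀ (norm_ne_zero_iff.2 hv)]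
  have hlim : Tendsto (fun δ : ℝ => ENNReal.ofReal (δ + ‖v‖) * μHE[n - 1] A) (𝓝[>] 0)
      (𝓝 (ENNReal.ofReal (0 + ‖v‖) * μHE[n - 1] A)) := by
    refine ENNReal.Tendsto.mul_const ?_ (Or.inr htop)
    exact (ENNReal.continuous_ofReal.comp (by fun_prop : Continuous fun δ : ℝ => δ + ‖v‖)).tendsto 0
      |>.mono_left nhdsWithin_le_nhds
  rw [zero_add] at hlim
  refine ge_of_tendsto hlim ?_
  filter_upwards [self_mem_nhdsWithin] with δ hδ
  have := volume_add_segment_le_add hn hν (norm_nonneg v) hδ hA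
  rwa [smul_smul, mul_inv_cancel₀ (norm_ne_zero_iff.2 hv), one_smul] at this

/-- Weighted form of `volume_add_segment_le`, obtained from it by the layer cake formula. -/
theorem lintegral_add_segment_le (hn : 1 ≤ n) {v : EuclideanSpace ℝ (Fin n)} (hv : v ≠ 0)
    {A : Set (EuclideanSpace ℝ (Fin n))} (hA : IsClosed A)
    {f : EuclideanSpace ℝ (Fin n) → ℝ} {K : ℝ≥0} (hf : LipschitzWith K f) (hf0 : ∀ x, 0 ≤ f x) :
    ∫⁻ x in A + segment ℝ 0 v, ENNReal.ofReal (f x) ≤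
      ENNReal.ofReal ‖v‖ * ∫⁻ x in A, ENNReal.ofReal (f x + K * ‖v‖) ∂μHE[n - 1] := by
  have hfm : Measurable f := hf.continuous.measurable
  rw [lintegral_eq_lintegral_meas_lt _ (.of_forall hf0) hfm.aemeasurable,
    lintegral_eq_lintegral_meas_lt _ (.of_forall fun x => by have := hf0 x; positivity)
      (by fun_prop), ← lintegral_const_mul' _ _ ENNReal.ofReal_ne_top]
  refine lintegral_mono fun t => ?_
  have hm1 : MeasurableSet {x | t < f x} := measurableSet_lt measurable_const hfm
  have hm2 : MeasurableSet {x | t < f x + K * ‖v‖} :=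
    measurableSet_lt measurable_const (by fun_prop)
  dsimp only
  rw [Measure.restrict_apply hm1, Measure.restrict_apply hm2]
  refine le_trans (measure_mono ?_) (volume_add_segment_le hn hv (hm2.inter hA.measurableSet))
  rintro _ ⟨ht, x, hx, y, hy, rfl⟩
  refine ⟨x, ⟨?_, hx⟩, y, hy, rfl⟩
  have hy' : ‖y‖ ≤ ‖v‖ := by
    rw [segment_eq_image] at hy
    obtain ⟨θ, hθ, rfl⟩ := hy
    simp only [smul_zero, zero_add, norm_smul, Real.norm_eq_abs, abs_of_nonneg hθ.1]
    exact mul_le_of_le_one_left (norm_nonneg v) hθ.2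
  have h1 := hf.dist_le_mul (x + y) x
  rw [dist_self_add_left, Real.dist_eq] at h1
  have h2 : (K : ℝ) * ‖y‖ ≤ K * ‖v‖ := by gcongr
  have h3 := le_abs_self (f (x + y) - f x)
  simp only [mem_ofPred_eq] at ht ⊢
  linarith

/-! ### Mollified indicator functions -/

/-- Mollification of the indicator function of `S` with the kernel `x ↦ ρ (-x)`. -/
noncomputable def smoothedIndicator (S : Set (EuclideanSpace ℝ (Fin n)))
    (ρ : EuclideanSpace ℝ (Fin n) → ℝ)
    (z : EuclideanSpace ℝ (Fin n)) : ℝ :=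
  ∫ x in S, ρ (x - z)

theorem contDiff_smoothedIndicator {S : Set (EuclideanSpace ℝ (Fin n))} (hS : MeasurableSet S)
    {ρ : EuclideanSpace ℝ (Fin n) → ℝ} (hρ : ContDiff ℝ ∞ ρ) (hρc : HasCompactSupport ρ) :
    ContDiff ℝ ∞ (smoothedIndicator S ρ) := by
  have h1 : LocallyIntegrable (S.indicator fun _ => (1 : ℝ)) volume :=
    (locallyIntegrable_const (1 : ℝ)).indicator hS
  have h2 : HasCompactSupport fun x => ρ (-x) := hρc.comp_homeomorph (Homeomorph.neg _)
  have h3 := h2.contDiff_convolution_right (n := ⊤) (ContinuousLinearMap.lsmul ℝ ℝ) h1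
    (hρ.comp contDiff_neg)
  convert h3 using 1
  ext z
  rw [convolution_def, smoothedIndicator, ← integral_indicator hS]
  congr 1
  ext x
  by_cases hx : x ∈ S <;> simp [hx]

/-- A segment that enters an open set from outside crosses its boundary. -/
theorem mem_frontier_add_segment {S : Set (EuclideanSpace ℝ (Fin n))} (hS : IsOpen S)
    {y v : EuclideanSpace ℝ (Fin n)} (hy : y ∉ S) (hyv : y + v ∈ S) :
    y ∈ frontier S + segment ℝ 0 (-v) := by
  have hpre : IsPreconnected (segment ℝ y (y + v)) := (convex_segment _ _).isPreconnected
  have hex : ∃ b ∈ segment ℝ y (y + v), b ∈ frontier S := by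
    by_contra! hno
    have hsub : segment ℝ y (y + v) ⊆ S ∪ (closure S)ᶜ := by
      intro b hb
      have := hno b hb
      rw [hS.frontier_eq] at this
      by_cases hbS : b ∈ S
      · exact Or.inl hbS
      · exact Or.inr fun hc => this ⟨hc, hbS⟩
    rcases isPreconnected_iff_subset_of_disjoint.1 hpre S (closure S)ᶜ hS
      isClosed_closure.isOpen_compl hsub (by
        ext b; simp only [mem_inter_iff, mem_compl_iff, mem_empty_iff_false, iff_false]
        rintro ⟨-, h1, h2⟩
        exact h2 (subset_closure h1)) with h | h
    · exact hy (h (left_mem_segment ℝ _ _))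
    · exact h (right_mem_segment ℝ _ _) (subset_closure hyv)
  obtain ⟨b, hb, hbS⟩ := hex
  rw [segment_eq_image'] at hb
  obtain ⟨θ, hθ, rfl⟩ := hb
  refine ⟨_, hbS, θ • (-v), ?_, ?_⟩
  · rw [segment_eq_image]
    exact ⟨θ, hθ, by simp⟩
  · simp

theorem integrable_of_continuous_of_hasCompactSupport {X : Type*} [TopologicalSpace X]
    [MeasurableSpace X] [OpensMeasurableSpace X] {f : X → ℝ} (hf : Continuous f)
    (hfc : HasCompactSupport f) (m : Measure X) [IsFiniteMeasure m] : Integrable f m := by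
  obtain ⟨C, hC⟩ := hf.bounded_above_of_compact_support hfc
  exact .of_bound hf.measurable.aestronglyMeasurable C (.of_forall hC)

theorem smoothedIndicator_add_sub_le (hn : 1 ≤ n) {S : Set (EuclideanSpace ℝ (Fin n))}
    (hS : IsOpen S) (hfin : μHE[n - 1] (frontier S) ≠ ⊤)
    {ρ : EuclideanSpace ℝ (Fin n) → ℝ} (hρc : HasCompactSupport ρ) (hρ0 : ∀ x, 0 ≤ ρ x)
    {K : ℝ≥0} (hK : LipschitzWith K ρ) (z : EuclideanSpace ℝ (Fin n))
    {v : EuclideanSpace ℝ (Fin n)} (hv : v ≠ 0) :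
    smoothedIndicator S ρ (z + v) - smoothedIndicator S ρ z ≤
      ‖v‖ * (∫ x in frontier S, ρ (x - z) ∂μHE[n - 1] +
        K * ‖v‖ * μHE[n - 1].real (frontier S)) := by
  set g : EuclideanSpace ℝ (Fin n) → ℝ := fun y => ρ (y - z) with hg
  have hgK : LipschitzWith K g := .of_dist_le_mul fun x y => by
    simpa [hg, dist_sub_right] using hK.dist_le_mul (x - z) (y - z)
  have hg0 : ∀ x, 0 ≤ g x := fun x => hρ0 _
  have hgc : HasCompactSupport g := hρc.comp_homeomorph (Homeomorph.subRight z)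
  have hgi : Integrable g := hgK.continuous.integrable_of_hasCompactSupport hgc
  have : IsFiniteMeasure (μHE[n - 1].restrict (frontier S)) :=
    ⟨by simpa using hfin.lt_top⟩
  have hgiH : Integrable g (μHE[n - 1].restrict (frontier S)) :=
    integrable_of_continuous_of_hasCompactSupport hgK.continuous hgc _
  set D := frontier S + segment ℝ 0 (-v) with hD
  have hDm : MeasurableSet D :=
    (isClosed_frontier.add_right_of_isCompact (by
      rw [segment_eq_image]
      exact isCompact_Icc.image (by fun_prop))).measurableSet
  have hshift : smoothedIndicator S ρ (z + v) = ∫ y in (fun y => y + v) ⁻¹' S, g y := by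
    have h := (measurePreserving_add_right (volume : Measure (EuclideanSpace ℝ (Fin n)))
      v).setIntegral_preimage_emb (MeasurableEquiv.addRight v).measurableEmbedding
      (fun x => ρ (x - (z + v))) S
    rw [smoothedIndicator, ← h]
    congr 1
    ext y
    simp only [hg]
    congr 1
    abel
  -- a point of `S - v` outside `S` lies in the swept set `D`
  have h1 : ∫ y in (fun y => y + v) ⁻¹' S, g y ≤ ∫ y in S ∪ D, g y := by
    refine setIntegral_mono_set hgi.integrableOn (.of_forall hg0) (.of_forall ?_)
    intro y hy
    by_cases hyS : y ∈ S
    · exact Or.inl hyS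
    · exact Or.inr (mem_frontier_add_segment hS hyS hy)
  have h2 : ∫ y in S ∪ D, g y ≤ (∫ y in S, g y) + ∫ y in D, g y := by
    rw [← union_sdiff_self, setIntegral_union disjoint_sdiff_right (hDm.diff hS.measurableSet)
      hgi.integrableOn hgi.integrableOn]
    refine add_le_add le_rfl ?_
    exact setIntegral_mono_set hgi.integrableOn (.of_forall hg0) (.of_forall fun _ hy => hy.1)
  have h3 : ∫ y in D, g y ≤ ‖v‖ * ∫ x in frontier S, (g x + K * ‖v‖) ∂μHE[n - 1] := by
    have hle := lintegral_add_segment_le hn (neg_ne_zero.2 hv) (isClosed_frontier (s := S)) hgK hg0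
    rw [norm_neg] at hle
    rw [integral_eq_lintegral_of_nonneg_ae (.of_forall hg0)
        hgK.continuous.measurable.aestronglyMeasurable,
      integral_eq_lintegral_of_nonneg_ae
        (.of_forall fun x => by have := hg0 x; positivity)
        (hgK.continuous.measurable.add_const _).aestronglyMeasurable,
      ← ENNReal.toReal_ofReal (norm_nonneg v), ← ENNReal.toReal_mul,
      ENNReal.toReal_ofReal (norm_nonneg v)]
    refine ENNReal.toReal_mono (ENNReal.mul_ne_top ENNReal.ofReal_ne_top ?_) hle
    exact (hgiH.add (integrable_const _)).lintegral_lt_top.ne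
  rw [integral_add hgiH (integrable_const _)] at h3
  simp only [integral_const, smul_eq_mul, measureReal_restrict_apply_univ] at h3
  have hz : smoothedIndicator S ρ z = ∫ y in S, g y := rfl
  rw [hshift, hz]
  have : μHE[n - 1].real (frontier S) * (K * ‖v‖) = K * ‖v‖ * μHE[n - 1].real (frontier S) :=
    mul_comm _ _
  rw [this] at h3
  exact sub_le_iff_le_add'.2 (h1.trans (h2.trans (add_le_add le_rfl h3)))

/-- The gradient of the mollified indicator function is bounded by the mollified surface measure.
Difference quotients compare `S` with a translate of itself, and the two differ by at most the set
swept by the boundary. -/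
theorem fderiv_smoothedIndicator_le (hn : 1 ≤ n) {S : Set (EuclideanSpace ℝ (Fin n))}
    (hS : IsOpen S) (hfin : μHE[n - 1] (frontier S) ≠ ⊤)
    {ρ : EuclideanSpace ℝ (Fin n) → ℝ} (hρ : ContDiff ℝ ∞ ρ) (hρc : HasCompactSupport ρ)
    (hρ0 : ∀ x, 0 ≤ ρ x) (z : EuclideanSpace ℝ (Fin n))
    {w : EuclideanSpace ℝ (Fin n)} (hw : ‖w‖ ≤ 1) :
    fderiv ℝ (smoothedIndicator S ρ) z w ≤ ∫ x in frontier S, ρ (x - z) ∂μHE[n - 1] := by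
  have hJ : 0 ≤ ∫ x in frontier S, ρ (x - z) ∂μHE[n - 1] := integral_nonneg fun x => hρ0 _
  rcases eq_or_ne w 0 with rfl | hw0
  · simpa using hJ
  obtain ⟨K, hK⟩ := hρ.lipschitzWith_of_hasCompactSupport hρc (by simp)
  have hd : HasFDerivAt (smoothedIndicator S ρ) (fderiv ℝ (smoothedIndicator S ρ) z) z :=
    ((contDiff_smoothedIndicator hS.measurableSet hρ hρc).differentiable (by simp) z).hasFDerivAt
  have hs := (hd.hasLineDerivAt w).tendsto_slope_zero_right
  have hlim : Tendsto (fun t : ℝ => ‖w‖ * (∫ x in frontier S, ρ (x - z) ∂μHE[n - 1] +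
      K * (t * ‖w‖) * μHE[n - 1].real (frontier S))) (𝓝[>] 0)
      (𝓝 (‖w‖ * (∫ x in frontier S, ρ (x - z) ∂μHE[n - 1] +
      K * (0 * ‖w‖) * μHE[n - 1].real (frontier S)))) :=
    ((by fun_prop : Continuous fun t : ℝ => ‖w‖ * (∫ x in frontier S, ρ (x - z) ∂μHE[n - 1] +
      K * (t * ‖w‖) * μHE[n - 1].real (frontier S))).tendsto 0).mono_left nhdsWithin_le_nhds
  have hle := le_of_tendsto_of_tendsto hs hlim (by
    filter_upwards [self_mem_nhdsWithin] with t ht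
    have ht0 : (0 : ℝ) < t := ht
    have := smoothedIndicator_add_sub_le hn hS hfin hρc hρ0 hK z (smul_ne_zero ht0.ne' hw0)
    rw [norm_smul, Real.norm_of_nonneg ht0.le] at this
    simp only [smul_eq_mul]
    rw [inv_mul_le_iff₀ ht0]
    linarith)
  refine hle.trans ?_
  simp only [zero_mul, mul_zero, add_zero]
  exact mul_le_of_le_one_left hJ hw

/-! ### Flux through the transition layer -/

/-- A continuous compactly supported field of linear forms can be integrated against a bounded
vector field. -/
theorem integrable_clm_apply {S : Set (EuclideanSpace ℝ (Fin n))}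
    (hSfin : volume S ≠ ⊤) {V : EuclideanSpace ℝ (Fin n) → EuclideanSpace ℝ (Fin n)}
    (hVm : AEStronglyMeasurable V (volume.restrict S))
    (hV1 : ∀ᵐ x ∂(volume.restrict S), ‖V x‖ ≤ 1)
    {G : EuclideanSpace ℝ (Fin n) → EuclideanSpace ℝ (Fin n) →L[ℝ] ℝ} (hG : Continuous G)
    (hGc : HasCompactSupport G) : Integrable (fun x => G x (V x)) (volume.restrict S) := by
  have : IsFiniteMeasure (volume.restrict S) := ⟨by simpa using hSfin.lt_top⟩
  obtain ⟨C, hC⟩ := hG.bounded_above_of_compact_support hGc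
  refine .of_bound ?_ C ?_
  · exact (isBoundedBilinearMap_apply (𝕜 := ℝ) (E := EuclideanSpace ℝ (Fin n))
      (F := ℝ)).continuous.comp_aestronglyMeasurable (hG.aestronglyMeasurable.prodMk hVm)
  · filter_upwards [hV1] with x hx
    calc ‖G x (V x)‖ ≤ ‖G x‖ * ‖V x‖ := (G x).le_opNorm _
      _ ≤ C * 1 := mul_le_mul (hC x) hx (norm_nonneg _) ((norm_nonneg _).trans (hC x))
      _ = C := mul_one C

theorem continuous_fderiv_of_contDiff {f : EuclideanSpace ℝ (Fin n) → ℝ} (hf : ContDiff ℝ ∞ f) :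
    Continuous (fderiv ℝ f) :=
  hf.continuous_fderiv (by simp)

section Kernel

variable {ρ : EuclideanSpace ℝ (Fin n) → ℝ} {S : Set (EuclideanSpace ℝ (Fin n))}

theorem smoothedIndicator_nonneg (hρ0 : ∀ x, 0 ≤ ρ x) (z : EuclideanSpace ℝ (Fin n)) :
    0 ≤ smoothedIndicator S ρ z :=
  integral_nonneg fun _ => hρ0 _

theorem smoothedIndicator_le_one (hρ0 : ∀ x, 0 ≤ ρ x) (hρi : Integrable ρ)
    (hρ1 : ∫ x, ρ x = 1) (z : EuclideanSpace ℝ (Fin n)) : smoothedIndicator S ρ z ≤ 1 := by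
  rw [← hρ1, ← integral_sub_right_eq_self ρ z]
  exact setIntegral_le_integral (hρi.comp_sub_right z) (.of_forall fun _ => hρ0 _)

theorem smoothedIndicator_eq_one (hρ1 : ∫ x, ρ x = 1) {z : EuclideanSpace ℝ (Fin n)}
    (hz : ∀ x ∉ S, ρ (x - z) = 0) : smoothedIndicator S ρ z = 1 := by
  rw [← hρ1, ← integral_sub_right_eq_self ρ z]
  exact setIntegral_eq_integral_of_forall_compl_eq_zero hz

theorem exists_mem_of_smoothedIndicator_ne_zero {z : EuclideanSpace ℝ (Fin n)}
    (hz : smoothedIndicator S ρ z ≠ 0) : ∃ x ∈ S, ρ (x - z) ≠ 0 := by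
  by_contra! h
  exact hz (setIntegral_eq_zero_of_forall_eq_zero h)

/-- Bound on the flux of a bounded field `V` across the transition layer of a mollified indicator
function translated by `a`, with weight `ζ`. Fubini's theorem turns the pointwise gradient bound
into an integral over the boundary. -/
theorem neg_integral_mul_fderiv_smoothedIndicator_le (hn : 1 ≤ n) (hS : IsOpen S)
    (hSfin : volume S ≠ ⊤) (hfin : μHE[n - 1] (frontier S) ≠ ⊤)
    (hρ : ContDiff ℝ ∞ ρ) (hρc : HasCompactSupport ρ) (hρ0 : ∀ x, 0 ≤ ρ x)
    (hρ1 : ∫ x, ρ x = 1) {ζ : EuclideanSpace ℝ (Fin n) → ℝ} (hζ : Continuous ζ)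
    (hζc : HasCompactSupport ζ) (hζ0 : ∀ x, 0 ≤ ζ x) {L : ℝ≥0} (hL : LipschitzWith L ζ)
    (a : EuclideanSpace ℝ (Fin n)) {δ : ℝ} (hδ : 0 ≤ δ)
    (hρa : ∀ x z, ρ (x - (z - a)) ≠ 0 → dist z x ≤ δ)
    {V : EuclideanSpace ℝ (Fin n) → EuclideanSpace ℝ (Fin n)}
    (hVm : AEStronglyMeasurable V (volume.restrict S))
    (hV1 : ∀ᵐ x ∂(volume.restrict S), ‖V x‖ ≤ 1) :
    -∫ z in S, ζ z * fderiv ℝ (fun z => smoothedIndicator S ρ (z - a)) z (V z) ≤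
      (∫ x in frontier S, ζ x ∂μHE[n - 1]) + L * δ * μHE[n - 1].real (frontier S) := by
  have : IsFiniteMeasure (volume.restrict S) := ⟨by simpa using hSfin.lt_top⟩
  have : IsFiniteMeasure (μHE[n - 1].restrict (frontier S)) :=
    ⟨by simpa using hfin.lt_top⟩
  have hφ : ContDiff ℝ ∞ (fun z => smoothedIndicator S ρ (z - a)) :=
    (contDiff_smoothedIndicator hS.measurableSet hρ hρc).comp (contDiff_id.sub contDiff_const)
  have hint1 : Integrable (fun z => ζ z * fderiv ℝ (fun z => smoothedIndicator S ρ (z - a)) z (V z))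
      (volume.restrict S) :=
    integrable_clm_apply hSfin hVm hV1
      (G := fun z => ζ z • fderiv ℝ (fun z => smoothedIndicator S ρ (z - a)) z)
      (hζ.smul (continuous_fderiv_of_contDiff hφ)) hζc.smul_right
  obtain ⟨C, hC⟩ := hζ.bounded_above_of_compact_support hζc
  obtain ⟨C', hC'⟩ := hρ.continuous.bounded_above_of_compact_support hρc
  have hint2 : Integrable (Function.uncurry fun z x => ζ z * ρ (x - (z - a)))
      ((volume.restrict S).prod (μHE[n - 1].restrict (frontier S))) := by
    have hρcont := hρ.continuous
    refine .of_bound (Continuous.aestronglyMeasurable (by unfold Function.uncurry; fun_prop))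
      (C * C') (.of_forall fun p => ?_)
    rw [Function.uncurry, norm_mul]
    exact mul_le_mul (hC _) (hC' _) (norm_nonneg _) ((norm_nonneg _).trans (hC p.1))
  have hρi : Integrable ρ := hρ.continuous.integrable_of_hasCompactSupport hρc
  rw [← integral_neg]
  calc ∫ z in S, -(ζ z * fderiv ℝ (fun z => smoothedIndicator S ρ (z - a)) z (V z))
      ≤ ∫ z in S, ∫ x in frontier S, ζ z * ρ (x - (z - a)) ∂μHE[n - 1] := by
        refine integral_mono_ae hint1.neg hint2.integral_prod_left ?_
        filter_upwards [hV1] with z hz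
        have h := fderiv_smoothedIndicator_le hn hS hfin hρ hρc hρ0 (z - a) (w := -V z)
          (by rwa [norm_neg])
        -- the gradient bound is used in the direction `-V z`
        rw [fderiv_comp_sub, integral_const_mul, ← mul_neg, ← map_neg]
        exact mul_le_mul_of_nonneg_left h (hζ0 z)
    _ = ∫ x in frontier S, (∫ z in S, ζ z * ρ (x - (z - a))) ∂μHE[n - 1] :=
        integral_integral_swap hint2
    _ ≤ ∫ x in frontier S, (ζ x + L * δ) ∂μHE[n - 1] := by
        have hζH := integrable_of_continuous_of_hasCompactSupport hζ hζc
          (μHE[n - 1].restrict (frontier S))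
        refine integral_mono hint2.integral_prod_right (hζH.add (integrable_const _)) fun x => ?_
        have hi : Integrable fun z => ρ (x - (z - a)) := by
          simpa [sub_sub_eq_add_sub] using hρi.comp_sub_left (x + a)
        have hone : ∫ z, ρ (x - (z - a)) = 1 := by
          rw [← hρ1, ← integral_sub_left_eq_self ρ volume (x + a)]
          simp [sub_sub_eq_add_sub]
        have hx : 0 ≤ ζ x + L * δ := add_nonneg (hζ0 x) (by positivity)
        calc ∫ z in S, ζ z * ρ (x - (z - a))
            ≤ ∫ z in S, (ζ x + L * δ) * ρ (x - (z - a)) := by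
              refine integral_mono_of_nonneg
                (.of_forall fun z => mul_nonneg (hζ0 z) (hρ0 _)) (hi.const_mul _).integrableOn
                (.of_forall fun z => ?_)
              by_cases h0 : ρ (x - (z - a)) = 0
              · simp [h0]
              refine mul_le_mul_of_nonneg_right ?_ (hρ0 _)
              have h1 := hL.dist_le_mul z x
              rw [Real.dist_eq] at h1
              have h2 : (L : ℝ) * dist z x ≤ L * δ := by gcongr; exact hρa x z h0
              linarith [le_abs_self (ζ z - ζ x)]
          _ = (ζ x + L * δ) * ∫ z in S, ρ (x - (z - a)) := integral_const_mul _ _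
          _ ≤ (ζ x + L * δ) * 1 := by
              refine mul_le_mul_of_nonneg_left ?_ hx
              rw [← hone]
              exact setIntegral_le_integral hi (.of_forall fun _ => hρ0 _)
          _ = ζ x + L * δ := mul_one _
    _ = _ := by
        have hζH := integrable_of_continuous_of_hasCompactSupport hζ hζc
          (μHE[n - 1].restrict (frontier S))
        rw [integral_add hζH (integrable_const _)]
        simp only [integral_const, smul_eq_mul, measureReal_restrict_apply_univ]
        rw [mul_comm (μHE[n - 1].real _)]

end Kernel

/-! ### The flux bound in a Lipschitz chart -/

/-- The defect in the integration by parts formula on `S`: the sum `∫_S ζ dμ + ∫_S V · ∇ζ`, where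
`μ = P - N` is the divergence of `V`. It vanishes on test functions in `S`; for a general `ζ` it
is the flux through `∂S` of `V` weighted with `ζ`. -/
noncomputable def boundaryFlux (S : Set (EuclideanSpace ℝ (Fin n)))
    (V : EuclideanSpace ℝ (Fin n) → EuclideanSpace ℝ (Fin n))
    (P N : Measure (EuclideanSpace ℝ (Fin n))) (ζ : EuclideanSpace ℝ (Fin n) → ℝ) : ℝ :=
  (∫ x in S, ζ x ∂P) - (∫ x in S, ζ x ∂N) + ∫ x in S, fderiv ℝ ζ x (V x)

theorem orthogonalProjectionOnto_add_smul (e x : EuclideanSpace ℝ (Fin n)) (t : ℝ) :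
    (ℝ ∙ e)ᗮ.orthogonalProjectionOnto (x + t • e) = (ℝ ∙ e)ᗮ.orthogonalProjectionOnto x := by
  rw [map_add, map_smul,
    Submodule.orthogonalProjectionOnto_orthogonalComplement_singleton_eq_zero e, smul_zero,
    add_zero]

/-- Points close to an epigraph translated upwards by `t` lie well inside the epigraph. -/
theorem graph_add_le_inner {e : EuclideanSpace ℝ (Fin n)} (he : ‖e‖ = 1) {K : ℝ≥0}
    {γ : (ℝ ∙ e)ᗮ → ℝ} (hγ : LipschitzWith K γ) {t ε : ℝ} (hε : (K + 1) * ε ≤ t / 2)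
    {x z : EuclideanSpace ℝ (Fin n)} (hx : γ ((ℝ ∙ e)ᗮ.orthogonalProjectionOnto x) < inner ℝ e x)
    (hxz : ‖x - (z - t • e)‖ ≤ ε) :
    γ ((ℝ ∙ e)ᗮ.orthogonalProjectionOnto z) + t / 2 ≤ inner ℝ e z := by
  set u := x - (z - t • e) with hu
  have h1 : inner ℝ e x = inner ℝ e z - t + inner ℝ e u := by
    rw [hu, inner_sub_right, inner_sub_right, inner_smul_right, real_inner_self_eq_norm_sq, he]
    ring
  have h2 : inner ℝ e u ≤ ε := by
    have := real_inner_le_norm e u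
    rw [he, one_mul] at this
    exact this.trans hxz
  have h3 : γ ((ℝ ∙ e)ᗮ.orthogonalProjectionOnto z) -
      γ ((ℝ ∙ e)ᗮ.orthogonalProjectionOnto x) ≤ K * ε := by
    have h4 : dist ((ℝ ∙ e)ᗮ.orthogonalProjectionOnto z)
        ((ℝ ∙ e)ᗮ.orthogonalProjectionOnto x) ≤ ε := by
      have hz : z = (z - t • e) + t • e := by abel
      rw [hz, orthogonalProjectionOnto_add_smul]
      refine ((Submodule.lipschitzWith_orthogonalProjectionOnto (ℝ ∙ e)ᗮ).dist_le_mul _ _).trans ?_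
      rw [NNReal.coe_one, one_mul, dist_comm, dist_eq_norm]
      exact hxz
    have h5 := hγ.dist_le_mul ((ℝ ∙ e)ᗮ.orthogonalProjectionOnto z)
      ((ℝ ∙ e)ᗮ.orthogonalProjectionOnto x)
    rw [Real.dist_eq] at h5
    exact (le_abs_self _).trans (h5.trans (by gcongr))
  linarith

/-- Near a boundary point of a Lipschitz set, the indicator function of `S` is approximated from
inside: the set is pushed inwards along the direction of the graph and then mollified at a much
smaller scale, so that the result vanishes near the boundary. -/
theorem exists_inner_approximation (hn : 1 ≤ n) {S : Set (EuclideanSpace ℝ (Fin n))}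
    (hS : IsOpen S) (hSfin : volume S ≠ ⊤) (hfin : μHE[n - 1] (frontier S) ≠ ⊤)
    {V : EuclideanSpace ℝ (Fin n) → EuclideanSpace ℝ (Fin n)}
    (hVm : AEStronglyMeasurable V (volume.restrict S))
    (hV1 : ∀ᵐ x ∂(volume.restrict S), ‖V x‖ ≤ 1)
    {x₀ e : EuclideanSpace ℝ (Fin n)} (he : ‖e‖ = 1) {K : ℝ≥0}
    {γ : (ℝ ∙ e)ᗮ → ℝ} (hγ : LipschitzWith K γ) {r : ℝ}
    (hr : ∀ y ∈ Metric.ball x₀ r,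
        (y ∈ S ↔ γ ((ℝ ∙ e)ᗮ.orthogonalProjectionOnto y) < inner ℝ e y))
    {ζ : EuclideanSpace ℝ (Fin n) → ℝ} (hζ : ContDiff ℝ ∞ ζ) (hζc : HasCompactSupport ζ)
    (hζ0 : ∀ x, 0 ≤ ζ x) (hζr : tsupport ζ ⊆ Metric.ball x₀ (r / 2))
    {L : ℝ≥0} (hL : LipschitzWith L ζ) {t : ℝ} (ht : 0 < t) (htr : 4 * t ≤ r) :
    ∃ φ : EuclideanSpace ℝ (Fin n) → ℝ, ContDiff ℝ ∞ φ ∧ (∀ z, 0 ≤ φ z) ∧ (∀ z, φ z ≤ 1) ∧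
      IsTestFunction S (fun z => ζ z * φ z) ∧
      (∀ z, Metric.ball z (2 * t) ⊆ S → φ z = 1) ∧
      -∫ z in S, ζ z * fderiv ℝ φ z (V z) ≤
        (∫ x in frontier S, ζ x ∂μHE[n - 1]) + L * (2 * t) * μHE[n - 1].real (frontier S) := by
  -- the scale `ε` is small enough for `graph_add_le_inner`
  obtain ⟨ε, hε0, hεt, hεK⟩ : ∃ ε : ℝ, 0 < ε ∧ ε < t ∧ (K + 1) * ε ≤ t / 2 := by
    have hK : (0 : ℝ) < K + 1 := by positivity
    refine ⟨t / (2 * (K + 1)), by positivity, ?_, le_of_eq (by field_simp)⟩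
    rw [div_lt_iff₀ (by positivity)]
    nlinarith [K.coe_nonneg]
  let b : ContDiffBump (0 : EuclideanSpace ℝ (Fin n)) := ⟨ε / 2, ε, by positivity, by linarith⟩
  set ρ : EuclideanSpace ℝ (Fin n) → ℝ := b.normed volume with hρdef
  have hρ : ContDiff ℝ ∞ ρ := b.contDiff_normed
  have hρc : HasCompactSupport ρ := b.hasCompactSupport_normed
  have hρ0 : ∀ x, 0 ≤ ρ x := b.nonneg_normed
  have hρ1 : ∫ x, ρ x = 1 := b.integral_normed
  have hρi : Integrable ρ := b.integrable_normed
  have hρε : ∀ u, ρ u ≠ 0 → ‖u‖ < ε := by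
    intro u hu
    have : u ∈ Function.support ρ := hu
    rwa [hρdef, b.support_normed_eq, mem_ball_zero_iff] at this
  have hρa : ∀ x z, ρ (x - (z - t • e)) ≠ 0 → dist z x < 2 * t := by
    intro x z hxz
    have h1 := hρε _ hxz
    have h2 : z - x = t • e - (x - (z - t • e)) := by abel
    rw [dist_eq_norm, h2]
    refine (norm_sub_le _ _).trans_lt ?_
    rw [norm_smul, he, mul_one, Real.norm_of_nonneg ht.le]
    linarith
  refine ⟨fun z => smoothedIndicator S ρ (z - t • e),
    (contDiff_smoothedIndicator hS.measurableSet hρ hρc).comp (contDiff_id.sub contDiff_const),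
    fun z => smoothedIndicator_nonneg hρ0 _, fun z => smoothedIndicator_le_one hρ0 hρi hρ1 _,
    ⟨?_, hζc.mul_right, ?_⟩, ?_, ?_⟩
  · exact hζ.mul
      ((contDiff_smoothedIndicator hS.measurableSet hρ hρc).comp (contDiff_id.sub contDiff_const))
  · set C : Set (EuclideanSpace ℝ (Fin n)) := tsupport ζ ∩
      {z | γ ((ℝ ∙ e)ᗮ.orthogonalProjectionOnto z) + t / 2 ≤ inner ℝ e z} with hC
    have hγc := hγ.continuous
    have hCc : IsClosed C := (isClosed_tsupport ζ).inter
      (isClosed_le (by fun_prop) (by fun_prop))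
    have hsub : tsupport (fun z => ζ z * smoothedIndicator S ρ (z - t • e)) ⊆ C := by
      refine closure_minimal ?_ hCc
      intro z hz
      have hz' := mul_ne_zero_iff.1 hz
      have hzζ : z ∈ tsupport ζ := subset_tsupport _ hz'.1
      refine ⟨hzζ, ?_⟩
      obtain ⟨x, hxS, hx⟩ := exists_mem_of_smoothedIndicator_ne_zero hz'.2
      have hxr : x ∈ Metric.ball x₀ r := by
        have h1 := hρa x z hx
        have h2 := Metric.mem_ball.1 (hζr hzζ)
        rw [Metric.mem_ball]
        have h3 := dist_triangle_left x x₀ z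
        linarith
      exact graph_add_le_inner he hγ hεK ((hr x hxr).1 hxS) (hρε _ hx).le
    refine hsub.trans ?_
    rintro z ⟨hz, hz2⟩
    have hzr : z ∈ Metric.ball x₀ r := by
      have h2 := Metric.mem_ball.1 (hζr hz)
      rw [Metric.mem_ball]
      linarith
    refine (hr z hzr).2 ?_
    have : γ ((ℝ ∙ e)ᗮ.orthogonalProjectionOnto z) + t / 2 ≤ inner ℝ e z := hz2
    linarith
  · intro z hz
    refine smoothedIndicator_eq_one hρ1 fun x hx => ?_
    by_contra h
    refine hx (hz ?_)
    rw [Metric.mem_ball, dist_comm]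
    exact hρa x z h
  · exact neg_integral_mul_fderiv_smoothedIndicator_le hn hS hSfin hfin hρ hρc hρ0 hρ1
      hζ.continuous hζc hζ0 hL (t • e) (by positivity) (fun x z h => (hρa x z h).le) hVm hV1

theorem fderiv_mul_apply {f g : EuclideanSpace ℝ (Fin n) → ℝ} (hf : ContDiff ℝ ∞ f)
    (hg : ContDiff ℝ ∞ g) (x v : EuclideanSpace ℝ (Fin n)) :
    fderiv ℝ (fun z => f z * g z) x v = g x * fderiv ℝ f x v + f x * fderiv ℝ g x v := by
  have := fderiv_mul (hf.differentiable (by simp) x) (hg.differentiable (by simp) x)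
  have h2 : fderiv ℝ (fun z => f z * g z) x = f x • fderiv ℝ g x + g x • fderiv ℝ f x := this
  rw [h2]
  simp
  ring

/-- Passage to the limit along test functions that approximate the indicator function of `S`. -/
theorem boundaryFlux_le_of_approximation {S : Set (EuclideanSpace ℝ (Fin n))}
    (hS : IsOpen S) (hSfin : volume S ≠ ⊤)
    {V : EuclideanSpace ℝ (Fin n) → EuclideanSpace ℝ (Fin n)}
    (hVm : AEStronglyMeasurable V (volume.restrict S))
    (hV1 : ∀ᵐ x ∂(volume.restrict S), ‖V x‖ ≤ 1)
    {P N : Measure (EuclideanSpace ℝ (Fin n))} [IsFiniteMeasure P] [IsFiniteMeasure N]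
    (hdiv : ∀ φ, IsTestFunction S φ → boundaryFlux S V P N φ = 0)
    {ζ : EuclideanSpace ℝ (Fin n) → ℝ} (hζ : ContDiff ℝ ∞ ζ) (hζc : HasCompactSupport ζ)
    (hζ0 : ∀ x, 0 ≤ ζ x) {φ : ℕ → EuclideanSpace ℝ (Fin n) → ℝ}
    (hφ : ∀ k, ContDiff ℝ ∞ (φ k)) (hφ0 : ∀ k z, 0 ≤ φ k z) (hφ1 : ∀ k z, φ k z ≤ 1)
    (hφtest : ∀ k, IsTestFunction S (fun z => ζ z * φ k z))
    (hφlim : ∀ z ∈ S, Tendsto (fun k => φ k z) atTop (𝓝 1)) {c : ℕ → ℝ} {C : ℝ}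
    (hc : Tendsto c atTop (𝓝 C))
    (hφle : ∀ k, -∫ z in S, ζ z * fderiv ℝ (φ k) z (V z) ≤ c k) :
    boundaryFlux S V P N ζ ≤ C := by
  have hmeas : ∀ (m : Measure (EuclideanSpace ℝ (Fin n))) [IsFiniteMeasure m],
      Tendsto (fun k => ∫ x in S, ζ x * φ k x ∂m) atTop (𝓝 (∫ x in S, ζ x ∂m)) := by
    intro m _
    refine tendsto_integral_of_dominated_convergence ζ
      (fun k => (hζ.continuous.mul (hφ k).continuous).aestronglyMeasurable)
      (integrable_of_continuous_of_hasCompactSupport hζ.continuous hζc _)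
      (fun k => .of_forall fun x => ?_) ?_
    · rw [Real.norm_of_nonneg (mul_nonneg (hζ0 x) (hφ0 k x))]
      exact mul_le_of_le_one_right (hζ0 x) (hφ1 k x)
    · filter_upwards [ae_restrict_mem hS.measurableSet] with x hx
      simpa using (hφlim x hx).const_mul (ζ x)
  have hi1 : Integrable (fun x => fderiv ℝ ζ x (V x)) (volume.restrict S) :=
    integrable_clm_apply hSfin hVm hV1 (continuous_fderiv_of_contDiff hζ) (hζc.fderiv ℝ)
  have hi2 : ∀ k, Integrable (fun x => φ k x * fderiv ℝ ζ x (V x)) (volume.restrict S) :=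
    fun k => by
      have hc : HasCompactSupport fun x => φ k x • fderiv ℝ ζ x :=
        (hζc.fderiv ℝ).mono fun x hx => (smul_ne_zero_iff.1 hx).2
      exact integrable_clm_apply hSfin hVm hV1
        ((hφ k).continuous.smul (continuous_fderiv_of_contDiff hζ)) hc
  have hi3 : ∀ k, Integrable (fun x => ζ x * fderiv ℝ (φ k) x (V x)) (volume.restrict S) :=
    fun k => integrable_clm_apply hSfin hVm hV1 (G := fun x => ζ x • fderiv ℝ (φ k) x)
      (hζ.continuous.smul (continuous_fderiv_of_contDiff (hφ k))) hζc.smul_right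
  have hgrad : Tendsto (fun k => ∫ x in S, φ k x * fderiv ℝ ζ x (V x)) atTop
      (𝓝 (∫ x in S, fderiv ℝ ζ x (V x))) := by
    refine tendsto_integral_of_dominated_convergence (fun x => ‖fderiv ℝ ζ x (V x)‖)
      (fun k => (hi2 k).aestronglyMeasurable) hi1.norm (fun k => .of_forall fun x => ?_) ?_
    · rw [norm_mul, Real.norm_of_nonneg (hφ0 k x)]
      exact mul_le_of_le_one_left (norm_nonneg _) (hφ1 k x)
    · filter_upwards [ae_restrict_mem hS.measurableSet] with x hx
      simpa using (hφlim x hx).mul_const (fderiv ℝ ζ x (V x))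
  refine le_of_tendsto_of_tendsto' (((hmeas P).sub (hmeas N)).add hgrad) hc fun k => ?_
  have h := hdiv _ (hφtest k)
  rw [boundaryFlux] at h
  simp only [fderiv_mul_apply hζ (hφ k)] at h
  rw [integral_add (hi2 k) (hi3 k)] at h
  have h2 := hφle k
  linarith

/-- The local flux bound: in a Lipschitz chart, the flux of `V` weighted with `ζ` is at most the
integral of `ζ` over the boundary. -/
theorem boundaryFlux_le_of_chart (hn : 1 ≤ n) {S : Set (EuclideanSpace ℝ (Fin n))}
    (hS : IsOpen S) (hSfin : volume S ≠ ⊤) (hfin : μHE[n - 1] (frontier S) ≠ ⊤)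
    {V : EuclideanSpace ℝ (Fin n) → EuclideanSpace ℝ (Fin n)}
    (hVm : AEStronglyMeasurable V (volume.restrict S))
    (hV1 : ∀ᵐ x ∂(volume.restrict S), ‖V x‖ ≤ 1)
    {P N : Measure (EuclideanSpace ℝ (Fin n))} [IsFiniteMeasure P] [IsFiniteMeasure N]
    (hdiv : ∀ φ, IsTestFunction S φ → boundaryFlux S V P N φ = 0)
    {x₀ e : EuclideanSpace ℝ (Fin n)} (he : ‖e‖ = 1) {K : ℝ≥0}
    {γ : (ℝ ∙ e)ᗮ → ℝ} (hγ : LipschitzWith K γ) {r : ℝ} (hr0 : 0 < r)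
    (hr : ∀ y ∈ Metric.ball x₀ r,
        (y ∈ S ↔ γ ((ℝ ∙ e)ᗮ.orthogonalProjectionOnto y) < inner ℝ e y))
    {ζ : EuclideanSpace ℝ (Fin n) → ℝ} (hζ : ContDiff ℝ ∞ ζ) (hζc : HasCompactSupport ζ)
    (hζ0 : ∀ x, 0 ≤ ζ x) (hζr : tsupport ζ ⊆ Metric.ball x₀ (r / 2)) :
    boundaryFlux S V P N ζ ≤ ∫ x in frontier S, ζ x ∂μHE[n - 1] := by
  obtain ⟨L, hL⟩ := hζ.lipschitzWith_of_hasCompactSupport hζc (by simp)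
  -- translation lengths tending to zero, small enough to stay inside the chart
  set t : ℕ → ℝ := fun k => r / 4 * (1 / ((k : ℝ) + 1)) with ht
  have ht0 : ∀ k, 0 < t k := fun k => by positivity
  have htr : ∀ k, 4 * t k ≤ r := fun k => by
    have : 1 / ((k : ℝ) + 1) ≤ 1 := by
      rw [div_le_one (by positivity)]
      linarith [(Nat.cast_nonneg k : (0 : ℝ) ≤ k)]
    have := mul_le_mul_of_nonneg_left this hr0.le
    simp only [ht]
    linarith
  have htlim : Tendsto t atTop (𝓝 0) := by
    simpa [ht] using (tendsto_one_div_add_atTop_nhds_zero_nat (𝕜 := ℝ)).const_mul (r / 4)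
  choose φ hφ hφ0 hφ1 hφtest hφball hφle using fun k =>
    exists_inner_approximation hn hS hSfin hfin hVm hV1 he hγ hr hζ hζc hζ0 hζr hL (ht0 k) (htr k)
  have hφlim : ∀ z ∈ S, Tendsto (fun k => φ k z) atTop (𝓝 1) := by
    intro z hz
    obtain ⟨δ, hδ, hball⟩ := Metric.isOpen_iff.1 hS z hz
    refine tendsto_const_nhds.congr' ?_
    filter_upwards [htlim.eventually (gt_mem_nhds (half_pos hδ))] with k hk
    exact (hφball k z ((Metric.ball_subset_ball (by linarith)).trans hball)).symm
  have hlim2 : Tendsto (fun k => (∫ x in frontier S, ζ x ∂μHE[n - 1]) +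
      L * (2 * t k) * μHE[n - 1].real (frontier S)) atTop
      (𝓝 ((∫ x in frontier S, ζ x ∂μHE[n - 1]) +
      L * (2 * 0) * μHE[n - 1].real (frontier S))) :=
    (((htlim.const_mul 2).const_mul (L : ℝ)).mul_const _).const_add _
  rw [mul_zero, mul_zero, zero_mul, add_zero] at hlim2
  exact boundaryFlux_le_of_approximation hS hSfin hVm hV1 hdiv hζ hζc hζ0 hφ hφ0 hφ1 hφtest hφlim
    hlim2 hφle

/-! ### The total divergence is at most the perimeter -/

theorem boundaryFlux_finset_sum {S : Set (EuclideanSpace ℝ (Fin n))} (hSfin : volume S ≠ ⊤)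
    {V : EuclideanSpace ℝ (Fin n) → EuclideanSpace ℝ (Fin n)}
    (hVm : AEStronglyMeasurable V (volume.restrict S))
    (hV1 : ∀ᵐ x ∂(volume.restrict S), ‖V x‖ ≤ 1)
    {P N : Measure (EuclideanSpace ℝ (Fin n))} [IsFiniteMeasure P] [IsFiniteMeasure N]
    {ι : Type*} (s : Finset ι) {ζ : ι → EuclideanSpace ℝ (Fin n) → ℝ}
    (hζ : ∀ i, ContDiff ℝ ∞ (ζ i)) (hζc : ∀ i, HasCompactSupport (ζ i)) :
    boundaryFlux S V P N (fun x => ∑ i ∈ s, ζ i x) = ∑ i ∈ s, boundaryFlux S V P N (ζ i) := by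
  have hf : ∀ x, fderiv ℝ (fun x => ∑ i ∈ s, ζ i x) x (V x) =
      ∑ i ∈ s, fderiv ℝ (ζ i) x (V x) := fun x => by
    rw [fderiv_fun_sum fun i _ => (hζ i).differentiable (by simp) x]
    simp
  simp only [boundaryFlux, hf, Finset.sum_add_distrib, Finset.sum_sub_distrib]
  rw [integral_finsetSum _ fun i _ => integrable_clm_apply hSfin hVm hV1
      (continuous_fderiv_of_contDiff (hζ i)) ((hζc i).fderiv ℝ),
    integral_finsetSum _ fun i _ =>
      integrable_of_continuous_of_hasCompactSupport (hζ i).continuous (hζc i) _,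
    integral_finsetSum _ fun i _ =>
      integrable_of_continuous_of_hasCompactSupport (hζ i).continuous (hζc i) _]

/-- The flux bound for sets with Lipschitz boundary, obtained from the local one by a partition of
unity. -/
theorem boundaryFlux_le (hn : 1 ≤ n) {S : Set (EuclideanSpace ℝ (Fin n))}
    (hS : IsOpen S) (hSfin : volume S ≠ ⊤) (hfin : μHE[n - 1] (frontier S) ≠ ⊤)
    (hLip : HasLipschitzBoundary S)
    {V : EuclideanSpace ℝ (Fin n) → EuclideanSpace ℝ (Fin n)}
    (hVm : AEStronglyMeasurable V (volume.restrict S))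
    (hV1 : ∀ᵐ x ∂(volume.restrict S), ‖V x‖ ≤ 1)
    {P N : Measure (EuclideanSpace ℝ (Fin n))} [IsFiniteMeasure P] [IsFiniteMeasure N]
    (hdiv : ∀ φ, IsTestFunction S φ → boundaryFlux S V P N φ = 0)
    {ψ : EuclideanSpace ℝ (Fin n) → ℝ} (hψ : ContDiff ℝ ∞ ψ) (hψc : HasCompactSupport ψ)
    (hψ0 : ∀ x, 0 ≤ ψ x) :
    boundaryFlux S V P N ψ ≤ ∫ x in frontier S, ψ x ∂μHE[n - 1] := by
  have : IsFiniteMeasure (μHE[n - 1].restrict (frontier S)) := ⟨by simpa using hfin.lt_top⟩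
  -- every point has an open neighbourhood on which the flux bound holds
  have hloc : ∀ x : EuclideanSpace ℝ (Fin n), ∃ U, IsOpen U ∧ x ∈ U ∧
      ∀ ζ : EuclideanSpace ℝ (Fin n) → ℝ, ContDiff ℝ ∞ ζ → HasCompactSupport ζ →
        (∀ x, 0 ≤ ζ x) → tsupport ζ ⊆ U →
        boundaryFlux S V P N ζ ≤ ∫ x in frontier S, ζ x ∂μHE[n - 1] := by
    intro x
    by_cases hx : x ∈ frontier S
    · obtain ⟨e, he, K, γ, hγ, r, hr0, hr⟩ := hLip x hx
      exact ⟨Metric.ball x (r / 2), Metric.isOpen_ball, Metric.mem_ball_self (by positivity),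
        fun ζ h1 h2 h3 h4 => boundaryFlux_le_of_chart hn hS hSfin hfin hVm hV1 hdiv he hγ hr0 hr
          h1 h2 h3 h4⟩
    by_cases hxS : x ∈ S
    · refine ⟨S, hS, hxS, fun ζ h1 h2 h3 h4 => ?_⟩
      rw [hdiv ζ ⟨h1, h2, h4⟩]
      exact integral_nonneg h3
    · refine ⟨(closure S)ᶜ, isClosed_closure.isOpen_compl,
        fun hc => hx (by rw [hS.frontier_eq]; exact ⟨hc, hxS⟩), fun ζ h1 h2 h3 h4 => ?_⟩
      have hnot : ∀ y ∈ S, y ∉ tsupport ζ := fun y hy hyt => h4 hyt (subset_closure hy)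
      have hz : ∀ y ∈ S, ζ y = 0 := fun y hy => image_eq_zero_of_notMem_tsupport (hnot y hy)
      have hz' : ∀ y ∈ S, fderiv ℝ ζ y (V y) = 0 := fun y hy => by
        rw [fderiv_of_notMem_tsupport ℝ (hnot y hy)]; rfl
      rw [boundaryFlux, setIntegral_eq_zero_of_forall_eq_zero hz,
        setIntegral_eq_zero_of_forall_eq_zero hz, setIntegral_eq_zero_of_forall_eq_zero hz']
      simpa using integral_nonneg h3
  choose U hUo hxU hU using hloc
  obtain ⟨η, hη⟩ := SmoothPartitionOfUnity.exists_isSubordinate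
    (modelWithCornersSelf ℝ (EuclideanSpace ℝ (Fin n))) isClosed_univ U hUo
    (fun x _ => mem_iUnion.2 ⟨x, hxU x⟩)
  have hfinite : {i | (Function.support (η i) ∩ tsupport ψ).Nonempty}.Finite :=
    η.locallyFinite.finite_nonempty_inter_compact hψc
  set s := hfinite.toFinset with hs
  set ζ : EuclideanSpace ℝ (Fin n) → EuclideanSpace ℝ (Fin n) → ℝ := fun i x => η i x * ψ x
    with hζdef
  have hζ : ∀ i, ContDiff ℝ ∞ (ζ i) := fun i => (η i).contMDiff.contDiff.mul hψ
  have hζc : ∀ i, HasCompactSupport (ζ i) := fun i => hψc.mul_left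
  have hζ0 : ∀ i x, 0 ≤ ζ i x := fun i x => mul_nonneg (η.nonneg i x) (hψ0 x)
  have hζt : ∀ i, tsupport (ζ i) ⊆ U i := fun i => (tsupport_mul_subset_left).trans (hη i)
  have hsum : ψ = fun x => ∑ i ∈ s, ζ i x := by
    ext x
    by_cases hx : x ∈ tsupport ψ
    · rw [← Finset.sum_mul, ← finsum_eq_sum_of_support_subset, η.sum_eq_one (mem_univ x), one_mul]
      intro i hi
      simp only [hs, Finite.coe_toFinset]
      exact ⟨x, hi, hx⟩
    · have := image_eq_zero_of_notMem_tsupport hx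
      simp [hζdef, this]
  rw [hsum, boundaryFlux_finset_sum hSfin hVm hV1 s hζ hζc, integral_finsetSum _ fun i _ =>
      integrable_of_continuous_of_hasCompactSupport (hζ i).continuous (hζc i) _]
  exact Finset.sum_le_sum fun i _ => hU i (ζ i) (hζ i) (hζc i) (hζ0 i) (hζt i)

/-- Smooth cutoff functions, obtained by dilating one bump function by the factors `k + 1`. -/
theorem exists_cutoff_sequence (n : ℕ) :
    ∃ (ψ : ℕ → EuclideanSpace ℝ (Fin n) → ℝ) (C : ℝ),
      (∀ k, ContDiff ℝ ∞ (ψ k)) ∧ (∀ k, HasCompactSupport (ψ k)) ∧ (∀ k x, 0 ≤ ψ k x) ∧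
      (∀ k x, ψ k x ≤ 1) ∧ (∀ x, Tendsto (fun k => ψ k x) atTop (𝓝 1)) ∧
      ∀ k x, ‖fderiv ℝ (ψ k) x‖ ≤ C * (1 / ((k : ℝ) + 1)) := by
  let b : ContDiffBump (0 : EuclideanSpace ℝ (Fin n)) := ⟨1, 2, one_pos, one_lt_two⟩
  have hb : ContDiff ℝ ∞ b := b.contDiff
  obtain ⟨C, hC⟩ := (continuous_fderiv_of_contDiff hb).bounded_above_of_compact_support
    (b.hasCompactSupport.fderiv ℝ)
  have hc : ∀ k : ℕ, (0 : ℝ) < 1 / ((k : ℝ) + 1) := fun k => by positivity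
  refine ⟨fun k x => b ((1 / ((k : ℝ) + 1)) • x), C, fun k => hb.comp (contDiff_const_smul _),
    fun k => b.hasCompactSupport.comp_smul (hc k).ne', fun k x => b.nonneg, fun k x => b.le_one,
    fun x => ?_, fun k x => ?_⟩
  · have h1 : Tendsto (fun k : ℕ => (1 / ((k : ℝ) + 1)) • x) atTop (𝓝 0) := by
      simpa using (tendsto_one_div_add_atTop_nhds_zero_nat (𝕜 := ℝ)).smul_const x
    have h2 := (hb.continuous.tendsto 0).comp h1
    rwa [b.one_of_mem_closedBall (by simp [b])] at h2
  · have h1 : HasFDerivAt (fun x => b ((1 / ((k : ℝ) + 1)) • x))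
        ((fderiv ℝ b ((1 / ((k : ℝ) + 1)) • x)).comp
          ((1 / ((k : ℝ) + 1)) • ContinuousLinearMap.id ℝ (EuclideanSpace ℝ (Fin n)))) x :=
      (hb.differentiable (by simp) _).hasFDerivAt.comp x
        ((hasFDerivAt_id x).const_smul (1 / ((k : ℝ) + 1)))
    rw [h1.fderiv, ContinuousLinearMap.comp_smul, ContinuousLinearMap.comp_id, norm_smul,
      Real.norm_of_nonneg (hc k).le, mul_comm]
    exact mul_le_mul_of_nonneg_right (hC _) (hc k).le

/-- The total divergence of a vector field of length at most one is at most the surface measure. -/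
theorem divergence_le_perimeter (hn : 1 ≤ n) {S : Set (EuclideanSpace ℝ (Fin n))}
    (hS : IsOpen S) (hSfin : volume S ≠ ⊤) (hfin : μHE[n - 1] (frontier S) ≠ ⊤)
    (hLip : HasLipschitzBoundary S)
    {V : EuclideanSpace ℝ (Fin n) → EuclideanSpace ℝ (Fin n)}
    (hVm : AEStronglyMeasurable V (volume.restrict S))
    (hV1 : ∀ᵐ x ∂(volume.restrict S), ‖V x‖ ≤ 1)
    {P N : Measure (EuclideanSpace ℝ (Fin n))} [IsFiniteMeasure P] [IsFiniteMeasure N]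
    (hdiv : ∀ φ, IsTestFunction S φ → boundaryFlux S V P N φ = 0) :
    P.real S - N.real S ≤ μHE[n - 1].real (frontier S) := by
  have : IsFiniteMeasure (volume.restrict S) := ⟨by simpa using hSfin.lt_top⟩
  have : IsFiniteMeasure (μHE[n - 1].restrict (frontier S)) := ⟨by simpa using hfin.lt_top⟩
  obtain ⟨ψ, C, hψ, hψc, hψ0, hψ1, hψlim, hψd⟩ := exists_cutoff_sequence n
  have hmeas : ∀ (m : Measure (EuclideanSpace ℝ (Fin n))) [IsFiniteMeasure m],
      Tendsto (fun k => ∫ x in S, ψ k x ∂m) atTop (𝓝 (m.real S)) := by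
    intro m _
    have h1 : ∫ x in S, (1 : ℝ) ∂m = m.real S := by simp
    rw [← h1]
    refine tendsto_integral_of_dominated_convergence (fun _ => 1)
      (fun k => (hψ k).continuous.aestronglyMeasurable) (integrable_const _)
      (fun k => .of_forall fun x => ?_) (.of_forall hψlim)
    rw [Real.norm_of_nonneg (hψ0 k x)]
    exact hψ1 k x
  have hgrad : Tendsto (fun k => ∫ x in S, fderiv ℝ (ψ k) x (V x)) atTop (𝓝 0) := by
    have h0 : Tendsto (fun k : ℕ => C * (1 / ((k : ℝ) + 1)) * volume.real S) atTop (𝓝 0) := by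
      simpa using ((tendsto_one_div_add_atTop_nhds_zero_nat (𝕜 := ℝ)).const_mul C).mul_const
        (volume.real S)
    refine squeeze_zero_norm (fun k => ?_) h0
    refine norm_setIntegral_le_of_norm_le_const_ae hSfin.lt_top ?_
    filter_upwards [hV1] with x hx
    exact ((fderiv ℝ (ψ k) x).le_opNorm _).trans
      ((mul_le_of_le_one_right (norm_nonneg _) hx).trans (hψd k x))
  have hlim := ((hmeas P).sub (hmeas N)).add hgrad
  rw [add_zero] at hlim
  refine le_of_tendsto' hlim fun k => ?_
  refine (boundaryFlux_le hn hS hSfin hfin hLip hVm hV1 hdiv (hψ k) (hψc k) (hψ0 k)).trans ?_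
  calc ∫ x in frontier S, ψ k x ∂μHE[n - 1] ≤ ∫ x in frontier S, (1 : ℝ) ∂μHE[n - 1] :=
        integral_mono (integrable_of_continuous_of_hasCompactSupport (hψ k).continuous (hψc k) _)
          (integrable_const _) (hψ1 k)
    _ = μHE[n - 1].real (frontier S) := by simp

/-- Test functions only see the Jordan decomposition of the divergence inside `S`. -/
theorem boundaryFlux_eq_zero_of_hasDivMeasure {S : Set (EuclideanSpace ℝ (Fin n))}
    {V : EuclideanSpace ℝ (Fin n) → EuclideanSpace ℝ (Fin n)}
    {μ : SignedMeasure (EuclideanSpace ℝ (Fin n))} (hμ : HasDivMeasure S V μ)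
    {φ : EuclideanSpace ℝ (Fin n) → ℝ} (hφ : IsTestFunction S φ) :
    boundaryFlux S V μ.toJordanDecomposition.posPart μ.toJordanDecomposition.negPart φ = 0 := by
  have hout : ∀ x ∉ S, φ x = 0 := fun x hx =>
    image_eq_zero_of_notMem_tsupport fun h => hx (hφ.2.2 h)
  have hi : ∀ (m : Measure (EuclideanSpace ℝ (Fin n))) [IsFiniteMeasure m],
      m.toSignedMeasure.Integrable φ := fun m _ => by
    rw [VectorMeasure.Integrable, Measure.variation_toSignedMeasure]
    exact integrable_of_continuous_of_hasCompactSupport hφ.1.continuous hφ.2.1 m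
  have h := hμ φ hφ
  rw [← μ.toSignedMeasure_toJordanDecomposition, JordanDecomposition.toSignedMeasure,
    VectorMeasure.integral_sub_vectorMeasure (hi _) (hi _), VectorMeasure.integral_toSignedMeasure,
    VectorMeasure.integral_toSignedMeasure] at h
  rw [boundaryFlux, setIntegral_eq_integral_of_forall_compl_eq_zero hout,
    setIntegral_eq_integral_of_forall_compl_eq_zero hout, h]
  ring

theorem apply_eq_posPart_sub_negPart {X : Type*} [MeasurableSpace X] (μ : SignedMeasure X)
    {S : Set X} (hS : MeasurableSet S) :
    μ S = μ.toJordanDecomposition.posPart.real S - μ.toJordanDecomposition.negPart.real S := by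
  conv_lhs => rw [← μ.toSignedMeasure_toJordanDecomposition]
  rw [JordanDecomposition.toSignedMeasure, sub_apply,
    Measure.toSignedMeasure_apply_measurable hS, Measure.toSignedMeasure_apply_measurable hS]

end CheegerField

theorem mainTheorem5 {n : ℕ} (hn : 1 ≤ n) (Ω : Set (EuclideanSpace ℝ (Fin n))) (hΩ : IsOpen Ω)
    (𝒮 : Set (Set (EuclideanSpace ℝ (Fin n))))
    (h𝒮 : ∀ S ∈ 𝒮, IsOpen S ∧ S.Nonempty ∧ S ⊆ Ω ∧ CheegerField.HasLipschitzBoundary S)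
    (hinf : CheegerField.cheegerConstant Ω = CheegerField.infIsoRatio 𝒮)
    (h : ℝ)
    (hV : ∀ S ∈ 𝒮, ∃ V : EuclideanSpace ℝ (Fin n) → EuclideanSpace ℝ (Fin n),
      CheegerField.MemXBV S V ∧
      (∀ᵐ x ∂(volume.restrict S), ‖V x‖ ≤ 1) ∧
      ∃ μ : SignedMeasure (EuclideanSpace ℝ (Fin n)), CheegerField.HasDivMeasure S V μ ∧
        (h : EReal) * ((volume S : ℝ≥0∞) : EReal) ≤ ((μ S : ℝ) : EReal)) :
    (h : EReal) ≤ ((CheegerField.cheegerConstant Ω : ℝ≥0∞) : EReal) := by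
  -- passing to `ENNReal.ofReal h` loses nothing, as the Cheeger constant is nonnegative
  suffices hofReal : ENNReal.ofReal h ≤ CheegerField.cheegerConstant Ω by
    refine le_trans ?_ (EReal.coe_ennreal_le_coe_ennreal_iff.2 hofReal)
    rw [EReal.coe_ennreal_ofReal]
    exact EReal.coe_le_coe_iff.2 (le_max_left _ _)
  rw [hinf, CheegerField.infIsoRatio]
  refine le_iInf₂ fun S hSmem => le_iInf fun hSfin => ?_
  obtain ⟨hS, hSne, -, hLip⟩ := h𝒮 S hSmem
  obtain ⟨V, hVX, hV1, μ, hμ, hle⟩ := hV S hSmem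
  have hpos : 0 < volume S := hS.measure_pos volume hSne
  rw [CheegerField.isoRatio, ENNReal.le_div_iff_mul_le (Or.inl hpos.ne') (Or.inl hSfin.ne)]
  by_cases hfin : μHE[n - 1] (frontier S) = ⊤
  · rw [hfin]; exact le_top
  have hper := CheegerField.divergence_le_perimeter hn hS hSfin.ne hfin hLip
    hVX.1.aestronglyMeasurable hV1
    (fun φ hφ => CheegerField.boundaryFlux_eq_zero_of_hasDivMeasure hμ hφ)
  rw [← CheegerField.apply_eq_posPart_sub_negPart μ hS.measurableSet] at hper
  have hreal : h * volume.real S ≤ μ S := by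
    rw [← ENNReal.ofReal_toReal hSfin.ne, EReal.coe_ennreal_ofReal,
      max_eq_left ENNReal.toReal_nonneg, ← EReal.coe_mul, EReal.coe_le_coe_iff] at hle
    exact hle
  rw [← ENNReal.ofReal_toReal hSfin.ne, ← ENNReal.ofReal_mul' ENNReal.toReal_nonneg,
    ← ENNReal.ofReal_toReal hfin]
  exact ENNReal.ofReal_le_ofReal (hreal.trans hper)
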